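/- Let $m\ge n\ge 1$ be integers and put $d=m+n$. Let $\mathbb{P}^1$ be the complex projective line, obtained by gluing $\operatorname{Spec}\mathbb{C}[u]$ and $\operatorname{Spec}\mathbb{C}[u^{-1}]$ along $\operatorname{Spec}\mathbb{C}[u,u^{-1}]$, and let $\mathcal{E}$ be the rank $2$ vector bundle on $\mathbb{P}^1$ which is trivial over these two charts and has transition matrix $$M=\begin{bmatrix} u^{d} & u^{m}\\ 0 & 1\end{bmatrix},$$ that is, fibre coordinates $g$ over the first chart and $h$ over the second are related by $h=Mg$ on the overlap (it is a nontrivial extension of $\mathcal{O}_{\mathbb{P}^1}$ by $\mathcal{O}_{\mathbb{P}^1}(-d)$). Let $\mathbb{P}(\mathcal{E})\to\mathbb{P}^1$ be the associated $\mathbb{P}^1$-bundle, glued from two copies of $\mathbb{A}^1\times\mathbb{P}^1$ via $(u,[g])\mapsto(u^{-1},[Mg])$. Then $\mathbb{P}(\mathcal{E})$ is isomorphic to the Nagata–Hirzebruch surface $\mathbb{F}_{2m-d}=\mathbb{P}\bigl(\mathcal{O}_{\mathbb{P}^1}\oplus\mathcal{O}_{\mathbb{P}^1}(-(2m-d))\bigr)$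 as a scheme over $\mathbb{C}$, by an isomorphism compatible with the projections to $\mathbb{P}^1$. -/

import Mathlib

open CategoryTheory CategoryTheory.Limits AlgebraicGeometry

noncomputable section

/-! ### Open immersions between `Proj`s coming from homogeneous localisations -/

namespace ProjLocalization

open HomogeneousIdeal HomogeneousLocalization

variable {A B σ τ : Type} [CommRing A] [SetLike σ A] [AddSubgroupClass σ A]
  [CommRing B] [SetLike τ B] [AddSubgroupClass τ B]
  {𝒜 : ℕ → σ} {ℬ : ℕ → τ} [GradedRing 𝒜] [GradedRing ℬ]

/-- If `f : A → B` is a graded homomorphism which is a localisation at one element `r` of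
degree `0`, the numerator of a homogeneous element can be taken homogeneous. -/
theorem exists_homogeneous (f : 𝒜 →+*ᵍ ℬ) (r : A) (hr : r ∈ 𝒜 0)
    (hsurj : ∀ b : B, ∃ (k : ℕ) (a : A), f r ^ k * b = f a) {i : ℕ} {b : B} (hb : b ∈ ℬ i) :
    ∃ (k : ℕ) (a : A), a ∈ 𝒜 i ∧ f r ^ k * b = f a := by
  obtain ⟨k, a, h⟩ := hsurj b
  have hmem : f a ∈ ℬ i := by
    rw [← h]
    have h0 : f r ^ k ∈ ℬ 0 := by
      simpa using SetLike.pow_mem_graded k (f.map_mem hr)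
    simpa using SetLike.mul_mem_graded h0 hb
  refine ⟨k, (DirectSum.decompose 𝒜 a i : A), (DirectSum.decompose 𝒜 a i).2, ?_⟩
  rw [f.map_directSumDecompose, h, DirectSum.decompose_of_mem_same _ hmem]

/-- The homomorphism `(A_s)₀ → (B_{f s})₀` induced by a graded localisation `f : A → B` at an
element `r` of degree `0` is itself a localisation at `r`. -/
theorem isLocalization_awayMap (f : 𝒜 →+*ᵍ ℬ)
    (r : A) (hr : r ∈ 𝒜 0) (r' : B) (hr' : r' ∈ ℬ 0) (hu : f r * r' = 1)
    (hsurj : ∀ b : B, ∃ (k : ℕ) (a : A), f r ^ k * b = f a)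
    (hinj : ∀ a : A, f a = 0 → ∃ k : ℕ, r ^ k * a = 0) {d : ℕ} (s : A) (hs : s ∈ 𝒜 d) :
    @IsLocalization.Away _ _ (Away.mk 𝒜 hs 0 r (by simpa using hr)) (Away ℬ (f s)) _
      (Away.map f s).toAlgebra := by
  let _ : Algebra (Away 𝒜 s) (Away ℬ (f s)) := (Away.map f s).toAlgebra
  have hfs : f s ∈ ℬ d := f.map_mem hs
  have hrk : ∀ k : ℕ, r ^ k ∈ 𝒜 0 := fun k => by simpa using SetLike.pow_mem_graded k hr
  have hmk : ∀ k : ℕ, (Away.mk 𝒜 hs 0 r (by simpa using hr)) ^ k =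
      Away.mk 𝒜 hs 0 (r ^ k) (by simpa using hrk k) := by
    intro k
    apply HomogeneousLocalization.val_injective
    simp only [HomogeneousLocalization.val_pow, Away.val_mk, Localization.mk_pow]
    congr 1
    ext
    simp
  have halg : ∀ x : Away 𝒜 s, algebraMap (Away 𝒜 s) (Away ℬ (f s)) x = Away.map f s x :=
    fun _ => rfl
  refine IsLocalization.Away.mk _ ?_ ?_ ?_
  · rw [halg, Away.map_mk f s hs]
    refine IsUnit.of_mul_eq_one (Away.mk ℬ hfs 0 r' (by simpa using hr')) ?_
    apply HomogeneousLocalization.val_injective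
    simp only [HomogeneousLocalization.val_mul, Away.val_mk, Localization.mk_mul,
      HomogeneousLocalization.val_one, hu]
    rw [← Localization.mk_one]
    congr 1
    ext
    simp
  · intro z
    obtain ⟨n, b, hb, rfl⟩ := Away.mk_surjective ℬ hfs z
    obtain ⟨k, a, ha, h⟩ := exists_homogeneous f r hr hsurj hb
    refine ⟨k, Away.mk 𝒜 hs n a ha, ?_⟩
    rw [← map_pow, hmk, halg, halg, Away.map_mk f s hs, Away.map_mk f s hs]
    apply HomogeneousLocalization.val_injective
    simp only [HomogeneousLocalization.val_mul, Away.val_mk, Localization.mk_mul]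
    rw [← h, map_pow, mul_comm b]
    congr 1
    ext
    simp
  · intro x y hxy
    obtain ⟨z, rfl⟩ : ∃ z, x = y + z := ⟨x - y, by ring⟩
    obtain ⟨n, a, ha, rfl⟩ := Away.mk_surjective 𝒜 hs z
    rw [map_add, add_eq_left, halg, Away.map_mk f s hs] at hxy
    have h0 := congrArg HomogeneousLocalization.val hxy
    rw [Away.val_mk, HomogeneousLocalization.val_zero, ← Localization.mk_zero 1,
      Localization.mk_eq_mk_iff, Localization.r_iff_exists] at h0
    obtain ⟨⟨_, l, rfl⟩, h0⟩ := h0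
    have h1 : f (s ^ l * a) = 0 := by simpa using h0
    obtain ⟨k, hk⟩ := hinj _ h1
    refine ⟨k, ?_⟩
    rw [mul_add, add_eq_left, hmk]
    apply HomogeneousLocalization.val_injective
    simp only [HomogeneousLocalization.val_mul, Away.val_mk, Localization.mk_mul]
    rw [HomogeneousLocalization.val_zero, ← Localization.mk_zero 1,
      Localization.mk_eq_mk_iff, Localization.r_iff_exists]
    refine ⟨⟨_, l, rfl⟩, ?_⟩
    simp only [Submonoid.coe_one, mul_zero, one_mul]
    rw [← hk]
    ring

/-- A graded localisation at one element of degree `0` induces an open immersion on `Proj`. -/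
theorem isOpenImmersion_map (f : 𝒜 →+*ᵍ ℬ) (hf : irrelevant ℬ ≤ (irrelevant 𝒜).map f)
    (r : A) (hr : r ∈ 𝒜 0) (r' : B) (hr' : r' ∈ ℬ 0) (hu : f r * r' = 1)
    (hsurj : ∀ b : B, ∃ (k : ℕ) (a : A), f r ^ k * b = f a)
    (hinj : ∀ a : A, f a = 0 → ∃ k : ℕ, r ^ k * a = 0) :
    IsOpenImmersion (Proj.map f hf) := by
  refine IsOpenImmersion.of_openCover_source _ (Proj.mapAffineOpenCover f hf).openCover ?_ ?_
  · intro p q hpq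
    have key : ∀ p q : ProjectiveSpectrum ℬ,
        ProjectiveSpectrum.comap f hf p = ProjectiveSpectrum.comap f hf q →
        ∀ b, b ∈ p.asHomogeneousIdeal → b ∈ q.asHomogeneousIdeal := by
      intro p q hpq b hb
      obtain ⟨k, a, h⟩ := hsurj b
      have ha : a ∈ (ProjectiveSpectrum.comap f hf p).asHomogeneousIdeal := by
        change f a ∈ p.asHomogeneousIdeal
        rw [← h]
        exact Ideal.mul_mem_left _ _ hb
      rw [hpq] at ha
      change f a ∈ q.asHomogeneousIdeal at ha
      rw [← h] at ha
      have hb' : b = r' ^ k * (f r ^ k * b) := by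
        rw [← mul_assoc, ← mul_pow, mul_comm r', hu, one_pow, one_mul]
      rw [hb']
      exact Ideal.mul_mem_left _ _ ha
    apply ProjectiveSpectrum.ext
    apply HomogeneousIdeal.ext
    ext b
    exact ⟨key p q hpq b, key q p hpq.symm b⟩
  · intro s
    have key : ∀ (d : ℕ) (hd : 0 < d) (t : A) (ht : t ∈ 𝒜 d),
        IsOpenImmersion (Proj.awayι ℬ (f t) (f.map_mem ht) hd ≫ Proj.map f hf) := by
      intro d hd t ht
      rw [Proj.awayι_comp_map f hf hd t ht]
      let _ : Algebra (Away 𝒜 t) (Away ℬ (f t)) := (Away.map f t).toAlgebra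
      have hloc := isLocalization_awayMap f r hr r' hr' hu hsurj hinj t ht
      have hopen : IsOpenImmersion (Spec.map (CommRingCat.ofHom (Away.map f t))) :=
        @IsOpenImmersion.of_isLocalization _ _ _ _ _ _ hloc
      exact IsOpenImmersion.comp _ _
    exact key s.1 s.1.2 s.2 s.2.2

end ProjLocalization

/-! ### The projective line over a ring and linear substitutions -/

namespace RuledSurface

open MvPolynomial

/-- The graded ring `R[X₀, X₁]`, i.e. the symmetric algebra of a free module of rank `2`. -/
abbrev coordGrading (R : Type) [CommRing R] : ℕ → Submodule R (MvPolynomial (Fin 2) R) :=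
  homogeneousSubmodule (Fin 2) R

instance coordGradedAlgebra (R : Type) [CommRing R] : GradedAlgebra (coordGrading R) :=
  MvPolynomial.gradedAlgebra

/-- The relative projective line `ℙ¹_R = Proj R[X₀, X₁]`. -/
abbrev ProjLineOver (R : Type) [CommRing R] : Scheme.{0} := Proj (coordGrading R)

/-- The structure morphism `ℙ¹_R ⟶ Spec R`. -/
def ProjLineOver.toSpec (R : Type) [CommRing R] :
    ProjLineOver R ⟶ Spec (CommRingCat.of R) :=
  Proj.toSpecZero (coordGrading R) ≫
    Spec.map (CommRingCat.ofHom (algebraMap R (coordGrading R 0)))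

section Substitution

variable {R S : Type} [CommRing R] [CommRing S]

/-- The graded homomorphism `R[X₀, X₁] → S[X₀, X₁]` which is `φ` on coefficients and
`Xᵢ ↦ ∑ⱼ Mᵢⱼ Xⱼ` on the variables. -/
def linSubst (φ : R →+* S) (M : GL (Fin 2) S) : coordGrading R →+*ᵍ coordGrading S where
  __ := eval₂Hom (C.comp φ) fun i => ∑ j, C (M.1 i j) * X j
  map_mem {i x} hx := by
    have h := IsHomogeneous.eval₂ ((mem_homogeneousSubmodule i x).mp hx) (C.comp φ)
      (fun i => ∑ j, C (M.1 i j) * X j) (n := 1)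
      (fun a => isHomogeneous_C _ _)
      (fun i => IsHomogeneous.sum _ _ _ fun j _ => isHomogeneous_C_mul_X _ _)
    rw [one_mul] at h
    exact h

@[simp] theorem linSubst_C (φ : R →+* S) (M : GL (Fin 2) S) (a : R) :
    linSubst φ M (C a) = C (φ a) := eval₂Hom_C _ _ _

@[simp] theorem linSubst_X (φ : R →+* S) (M : GL (Fin 2) S) (i : Fin 2) :
    linSubst φ M (X i) = ∑ j, C (M.1 i j) * X j := eval₂Hom_X' _ _ _

theorem sum_inv_linSubst (φ : R →+* S) (M : GL (Fin 2) S) (j : Fin 2) :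
    ∑ i, C ((M⁻¹).1 j i) * linSubst φ M (X i) = X j := by
  have h : (M⁻¹).1 * M.1 = 1 := by rw [← Units.val_mul, inv_mul_cancel, Units.val_one]
  simp only [linSubst_X, Finset.mul_sum]
  rw [Finset.sum_comm]
  have : ∀ k, ∑ i, (C ((M⁻¹).1 j i) * (C (M.1 i k) * X k) : MvPolynomial (Fin 2) S) =
      C ((1 : Matrix (Fin 2) (Fin 2) S) j k) * X k := by
    intro k
    rw [← h, Matrix.mul_apply, map_sum, Finset.sum_mul]
    simp only [map_mul, mul_assoc]
  simp only [this, Matrix.one_apply]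
  simp

theorem irrelevant_le_linSubst (φ : R →+* S) (M : GL (Fin 2) S) :
    HomogeneousIdeal.irrelevant (coordGrading S) ≤
      (HomogeneousIdeal.irrelevant (coordGrading R)).map (linSubst φ M) := by
  have hX : ∀ j, (X j : MvPolynomial (Fin 2) S) ∈
      ((HomogeneousIdeal.irrelevant (coordGrading R)).map (linSubst φ M)).toIdeal := by
    intro j
    rw [← sum_inv_linSubst φ M j]
    refine Ideal.sum_mem _ fun i _ => Ideal.mul_mem_left _ _ ?_
    exact Ideal.mem_map_of_mem (linSubst φ M)
      (HomogeneousIdeal.mem_irrelevant_of_mem _ one_pos (isHomogeneous_X R i))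
  refine (HomogeneousIdeal.irrelevant_le _).mpr fun i hi p hp => ?_
  have h1 : p ∈ Ideal.span (X '' (Set.univ : Set (Fin 2)) : Set (MvPolynomial (Fin 2) S)) := by
    rw [mem_ideal_span_X_image]
    intro m hm
    by_contra! hcon
    have hm0 : m = 0 := by ext k; exact hcon k (Set.mem_univ k)
    have := IsHomogeneous.coeff_eq_zero ((mem_homogeneousSubmodule i p).mp hp) (d := m)
      (by rw [hm0]; simpa using hi.ne)
    exact (mem_support_iff.mp hm) this
  refine (Ideal.span_le.mpr ?_) h1
  rintro _ ⟨j, -, rfl⟩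
  exact hX j

/-- The morphism `ℙ¹_S ⟶ ℙ¹_R` which lies over `Spec φ : Spec S ⟶ Spec R` and is given in
homogeneous coordinates by `[x] ↦ [M x]`. -/
def linMap (φ : R →+* S) (M : GL (Fin 2) S) : ProjLineOver S ⟶ ProjLineOver R :=
  Proj.map (linSubst φ M) (irrelevant_le_linSubst φ M)

/-- `linMap φ M` lies over `Spec φ`. -/
theorem linMap_toSpec (φ : R →+* S) (M : GL (Fin 2) S) :
    linMap φ M ≫ ProjLineOver.toSpec R =
      ProjLineOver.toSpec S ≫ Spec.map (CommRingCat.ofHom φ) := by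
  refine (Proj.mapAffineOpenCover (linSubst φ M)
    (irrelevant_le_linSubst φ M)).openCover.hom_ext _ _ fun s => ?_
  have key : ∀ (d : ℕ) (hd : 0 < d) (t : MvPolynomial (Fin 2) R) (ht : t ∈ coordGrading R d),
      Proj.awayι (coordGrading S) (linSubst φ M t) ((linSubst φ M).map_mem ht) hd ≫
          linMap φ M ≫ ProjLineOver.toSpec R =
        Proj.awayι (coordGrading S) (linSubst φ M t) ((linSubst φ M).map_mem ht) hd ≫
          ProjLineOver.toSpec S ≫ Spec.map (CommRingCat.ofHom φ) := by
    intro d hd t ht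
    rw [linMap, Proj.awayι_comp_map_assoc _ _ hd t ht, ProjLineOver.toSpec, ProjLineOver.toSpec,
      Category.assoc, Proj.awayι_toSpecZero_assoc, Proj.awayι_toSpecZero_assoc,
      ← Spec.map_comp, ← Spec.map_comp, ← Spec.map_comp, ← Spec.map_comp,
      ← CommRingCat.ofHom_comp, ← CommRingCat.ofHom_comp, ← CommRingCat.ofHom_comp,
      ← CommRingCat.ofHom_comp]
    have hring : (HomogeneousLocalization.Away.map (linSubst φ M) t).comp
        ((HomogeneousLocalization.fromZeroRingHom (coordGrading R) (Submonoid.powers t)).comp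
          (algebraMap R (coordGrading R 0))) =
        ((HomogeneousLocalization.fromZeroRingHom (coordGrading S)
          (Submonoid.powers (linSubst φ M t))).comp (algebraMap S (coordGrading S 0))).comp φ := by
      ext1 a
      have hR : HomogeneousLocalization.fromZeroRingHom (coordGrading R) (Submonoid.powers t)
          (algebraMap R (coordGrading R 0) a) =
          HomogeneousLocalization.Away.mk (coordGrading R) ht 0 (C a)
            (by rw [zero_smul]; exact isHomogeneous_C _ a) := by
        apply HomogeneousLocalization.val_injective
        rw [HomogeneousLocalization.Away.val_mk]
        refine (HomogeneousLocalization.val_mk _).trans ?_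
        congr 1
      have hS : HomogeneousLocalization.fromZeroRingHom (coordGrading S)
          (Submonoid.powers (linSubst φ M t)) (algebraMap S (coordGrading S 0) (φ a)) =
          HomogeneousLocalization.Away.mk (coordGrading S) ((linSubst φ M).map_mem ht) 0 (C (φ a))
            (by rw [zero_smul]; exact isHomogeneous_C _ (φ a)) := by
        apply HomogeneousLocalization.val_injective
        rw [HomogeneousLocalization.Away.val_mk]
        refine (HomogeneousLocalization.val_mk _).trans ?_
        congr 1
      rw [RingHom.comp_apply, RingHom.comp_apply, RingHom.comp_apply, RingHom.comp_apply, hR, hS,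
        HomogeneousLocalization.Away.map_mk _ _ ht]
      apply HomogeneousLocalization.val_injective
      rw [HomogeneousLocalization.Away.val_mk, HomogeneousLocalization.Away.val_mk, linSubst_C]
      rfl
    exact congrArg (fun g : R →+* HomogeneousLocalization.Away (coordGrading S) (linSubst φ M t) =>
      Spec.map (CommRingCat.ofHom g)) hring
  exact key s.1 s.1.2 s.2 s.2.2

theorem linSubst_id_linSubst (φ : R →+* S) (M N : GL (Fin 2) S) (p : MvPolynomial (Fin 2) R) :
    linSubst (RingHom.id S) M (linSubst φ N p) = linSubst φ (N * M) p := by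
  have h : (linSubst (RingHom.id S) M).toRingHom.comp (linSubst φ N).toRingHom =
      (linSubst φ (N * M)).toRingHom := by
    refine MvPolynomial.ringHom_ext (fun a => ?_) (fun i => ?_)
    · change linSubst (RingHom.id S) M (linSubst φ N (C a)) = linSubst φ (N * M) (C a)
      rw [linSubst_C, linSubst_C, linSubst_C, RingHom.id_apply]
    · change linSubst (RingHom.id S) M (linSubst φ N (X i)) = linSubst φ (N * M) (X i)
      rw [linSubst_X, linSubst_X, map_sum]
      have h1 : ∀ j, linSubst (RingHom.id S) M (C (N.1 i j) * X j) =
          ∑ k, C (N.1 i j * M.1 j k) * X k := by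
        intro j
        rw [GradedRingHom.map_mul, linSubst_C, linSubst_X, Finset.mul_sum]
        simp only [RingHom.id_apply, C_mul, mul_assoc]
      simp only [h1, Units.val_mul, Matrix.mul_apply, map_sum, Finset.sum_mul]
      exact Finset.sum_comm
  exact DFunLike.congr_fun h p

theorem linSubst_one (φ : R →+* S) (p : MvPolynomial (Fin 2) R) :
    linSubst φ 1 p = MvPolynomial.map φ p := by
  have h : (linSubst φ 1).toRingHom = MvPolynomial.map φ := by
    refine MvPolynomial.ringHom_ext (fun a => ?_) (fun i => ?_)
    · change linSubst φ 1 (C a) = _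
      rw [linSubst_C, map_C]
    · change linSubst φ 1 (X i) = _
      rw [linSubst_X, map_X]
      simp [Matrix.one_apply]
  exact DFunLike.congr_fun h p

/-- If `φ` is the localisation at one element, `linMap φ M` is an open immersion. -/
theorem isOpenImmersion_linMap (φ : R →+* S) (M : GL (Fin 2) S) (r : R)
    (h : @IsLocalization.Away _ _ r S _ φ.toAlgebra) : IsOpenImmersion (linMap φ M) := by
  let _ : Algebra R S := φ.toAlgebra
  have hφ : algebraMap R S = φ := rfl
  have hu := IsLocalization.Away.algebraMap_isUnit (S := S) r
  obtain ⟨r', hr'⟩ := hu.exists_right_inv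
  rw [hφ] at hr'
  let _ : Algebra (MvPolynomial (Fin 2) R) (MvPolynomial (Fin 2) S) :=
    MvPolynomial.algebraMvPolynomial
  have hloc : IsLocalization ((Submonoid.powers r).map (C (σ := Fin 2)))
    (MvPolynomial (Fin 2) S) := inferInstance
  have halg : algebraMap (MvPolynomial (Fin 2) R) (MvPolynomial (Fin 2) S) =
    MvPolynomial.map φ := rfl
  refine ProjLocalization.isOpenImmersion_map _ _ (C r) (isHomogeneous_C _ _) (C r')
    (isHomogeneous_C _ _) ?_ ?_ ?_
  · rw [linSubst_C, ← map_mul, hr', map_one]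
  · intro b
    obtain ⟨⟨a, ⟨_, _, ⟨k, rfl⟩, rfl⟩⟩, hk⟩ :=
      IsLocalization.surj ((Submonoid.powers r).map (C (σ := Fin 2)))
        (linSubst (RingHom.id S) M⁻¹ b)
    refine ⟨k, a, ?_⟩
    have h2 := congrArg (linSubst (RingHom.id S) M) hk
    rw [halg, ← linSubst_one, ← linSubst_one, GradedRingHom.map_mul, linSubst_id_linSubst,
      linSubst_id_linSubst, linSubst_id_linSubst, inv_mul_cancel, one_mul] at h2
    rw [← h2, mul_comm, linSubst_one, map_id]
    congr 1
    change _ = linSubst φ M (C (r ^ k))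
    rw [linSubst_C, linSubst_C, map_pow, map_pow]
  · intro a ha
    have h2 := congrArg (linSubst (RingHom.id S) M⁻¹) ha
    rw [linSubst_id_linSubst, mul_inv_cancel, linSubst_one, map_zero, ← halg,
      ← map_zero (algebraMap (MvPolynomial (Fin 2) R) (MvPolynomial (Fin 2) S))] at h2
    obtain ⟨⟨_, _, ⟨k, rfl⟩, rfl⟩, hk⟩ := IsLocalization.exists_of_eq
      (M := (Submonoid.powers r).map (C (σ := Fin 2))) h2
    exact ⟨k, by simpa using hk⟩

end Substitution

/-! ### The projective line over `ℂ` and bundles on it -/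

open LaurentPolynomial

/-- The inclusion `ℂ[u] → ℂ[u, u⁻¹]`, `u ↦ u`, of the coordinate ring of the first chart. -/
def chart₀ : Polynomial ℂ →+* ℂ[T;T⁻¹] := Polynomial.toLaurent

/-- The inclusion `ℂ[w] → ℂ[u, u⁻¹]`, `w ↦ u⁻¹`, of the coordinate ring of the second chart. -/
def chart₁ : Polynomial ℂ →+* ℂ[T;T⁻¹] :=
  (LaurentPolynomial.invert (R := ℂ)).toRingEquiv.toRingHom.comp Polynomial.toLaurent

theorem isLocalization_chart₀ :
    @IsLocalization.Away _ _ (Polynomial.X : Polynomial ℂ) ℂ[T;T⁻¹] _ chart₀.toAlgebra :=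
  LaurentPolynomial.isLocalization

theorem isLocalization_chart₁ :
    @IsLocalization.Away _ _ (Polynomial.X : Polynomial ℂ) ℂ[T;T⁻¹] _ chart₁.toAlgebra :=
  @IsLocalization.isLocalization_of_algEquiv _ _ _ _ _ _ _ _ chart₁.toAlgebra
    isLocalization_chart₀
    (@AlgEquiv.ofRingEquiv _ _ _ _ _ _ chart₀.toAlgebra chart₁.toAlgebra
      (LaurentPolynomial.invert (R := ℂ)).toRingEquiv fun _ => rfl)

instance : IsOpenImmersion (Spec.map (CommRingCat.ofHom chart₀)) :=
  @IsOpenImmersion.of_isLocalization _ _ _ _ chart₀.toAlgebra _ isLocalization_chart₀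

instance : IsOpenImmersion (Spec.map (CommRingCat.ofHom chart₁)) :=
  @IsOpenImmersion.of_isLocalization _ _ _ _ chart₁.toAlgebra _ isLocalization_chart₁

instance (M : GL (Fin 2) ℂ[T;T⁻¹]) : IsOpenImmersion (linMap chart₀ M) :=
  isOpenImmersion_linMap chart₀ M _ isLocalization_chart₀

instance (M : GL (Fin 2) ℂ[T;T⁻¹]) : IsOpenImmersion (linMap chart₁ M) :=
  isOpenImmersion_linMap chart₁ M _ isLocalization_chart₁

/-- The complex projective line: `Spec ℂ[u]` and `Spec ℂ[w]` glued along `Spec ℂ[u, u⁻¹]`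
via `w = u⁻¹`. -/
def P1 : Scheme.{0} :=
  pushout (Spec.map (CommRingCat.ofHom chart₀)) (Spec.map (CommRingCat.ofHom chart₁))

/-- The structure morphism `ℙ¹ ⟶ Spec ℂ`. -/
def P1.toSpec : P1 ⟶ Spec (CommRingCat.of ℂ) :=
  pushout.desc (Spec.map (CommRingCat.ofHom Polynomial.C))
    (Spec.map (CommRingCat.ofHom Polynomial.C)) (by
      rw [← Spec.map_comp, ← Spec.map_comp, ← CommRingCat.ofHom_comp, ← CommRingCat.ofHom_comp]
      congr 2
      ext a
      simp [chart₀, chart₁])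

/-- A rank `2` vector bundle on `ℙ¹`, given by its transition matrix `M ∈ GL₂(ℂ[u, u⁻¹])`: it is
trivial on both charts, and the fibre coordinate `g` over the first chart and the fibre
coordinate `h` over the second chart are related by `h = M g` on the overlap. In particular its
sections are the pairs of vectors `g` over `ℂ[u]` and `h` over `ℂ[u⁻¹]` with `M g = h`. -/
structure RankTwoBundle where
  /-- The transition matrix. -/
  transition : GL (Fin 2) ℂ[T;T⁻¹]

namespace RankTwoBundle

variable (E : RankTwoBundle)

/-- The total space of the projectivisation `ℙ(E)`: two copies of `𝔸¹ × ℙ¹` glued along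
`(u, [g]) ↦ (u⁻¹, [M g])`, where `M` is the transition matrix of `E`. -/
def proj : Scheme.{0} :=
  pushout (linMap chart₀ 1) (linMap chart₁ E.transition)

/-- The bundle projection `ℙ(E) ⟶ ℙ¹`. -/
def projToP1 : E.proj ⟶ P1 :=
  pushout.map _ _ _ _ (ProjLineOver.toSpec _) (ProjLineOver.toSpec _) (ProjLineOver.toSpec _)
    (linMap_toSpec _ _) (linMap_toSpec _ _)

/-- The structure morphism of `ℙ(E)` as a scheme over `ℂ`. -/
def projToSpec : E.proj ⟶ Spec (CommRingCat.of ℂ) :=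
  E.projToP1 ≫ P1.toSpec

end RankTwoBundle

/-- The transition function of the line bundle `𝒪(k)` on `ℙ¹`, that is `u⁻ᵏ`: a section is a
pair `g ∈ ℂ[u]`, `h ∈ ℂ[u⁻¹]` with `h = u⁻ᵏ g`. -/
def lineTransition (k : ℤ) : ℂ[T;T⁻¹] := T (-k)

/-- The bundle `𝒪(a) ⊕ 𝒪(b)` on `ℙ¹`. -/
def lineSum (a b : ℤ) : RankTwoBundle where
  transition := Matrix.GeneralLinearGroup.mk'' !![lineTransition a, 0; 0, lineTransition b] (by
    rw [Matrix.det_fin_two_of, mul_zero, sub_zero, lineTransition, lineTransition, ← T_add]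
    exact isUnit_T _)

/-- The rank `2` bundle on `ℙ¹` with transition matrix `(uᵈ uᵐ; 0 1)`, an extension of `𝒪` by
`𝒪(-d)`. -/
def extBundle (d m : ℕ) : RankTwoBundle where
  transition := Matrix.GeneralLinearGroup.mk'' !![T (d : ℤ), T (m : ℤ); 0, 1] (by
    rw [Matrix.det_fin_two_of, mul_zero, sub_zero, mul_one]
    exact isUnit_T _)

/-- The bundle `𝒪 ⊕ 𝒪(-e)`, whose projectivisation is the Nagata-Hirzebruch surface `𝔽ₑ`. -/
def hirzebruchBundle (e : ℕ) : RankTwoBundle := lineSum 0 (-(e : ℤ))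

/-- The Nagata-Hirzebruch surface `𝔽ₑ = ℙ(𝒪 ⊕ 𝒪(-e))`, for `e ≥ 0`. -/
def Hirzebruch (e : ℕ) : Scheme.{0} := (hirzebruchBundle e).proj

/-- The ruling `𝔽ₑ ⟶ ℙ¹`. -/
def Hirzebruch.toP1 (e : ℕ) : Hirzebruch e ⟶ P1 := (hirzebruchBundle e).projToP1

/-- The structure morphism of `𝔽ₑ` as a scheme over `ℂ`. -/
def Hirzebruch.toSpec (e : ℕ) : Hirzebruch e ⟶ Spec (CommRingCat.of ℂ) :=
  (hirzebruchBundle e).projToSpec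

end RuledSurface

end

noncomputable section

namespace RuledSurface

open MvPolynomial HomogeneousLocalization

/-! ### Composition of linear substitutions, and triviality of scalars -/

section Substitution

variable {R S T : Type} [CommRing R] [CommRing S] [CommRing T]

/-! A bundle on `P1` does not change under invertible changes of frame `A` over `ℂ[u]` and `B` over
`ℂ[u⁻¹]`, and its projectivisation does not change when the transition matrix is multiplied by a
unit of `ℂ[u, u⁻¹]`, that is, when the bundle is twisted by a line bundle. So it is enough to solve
`B M = diag(1, u^(m-n)) A z`. The row operation `-u⁻ᵐ · (row 1) + (row 2)`, regular over the second
chart, turns the rows of `M` into `(-uⁿ, 0)` and `(uᵐ⁺ⁿ, uᵐ)`. Pulling out `z = uⁿ` and `diag(1,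
u^(m-n))` leaves a matrix `A` that is invertible over `ℂ[u]`. Thus the bundle is `𝒪(-n) ⊕ 𝒪(-m)`,
the twist of `𝒪 ⊕ 𝒪(-(m-n))` by `𝒪(-n)`.

Two facts turn this matrix identity into geometry: `linMap_comp_linMap` makes matrices act
functorially on projective lines, and `linMap_scalar` makes scalars act trivially. With them
`projMap` glues the two frame changes, and `splittingFrame_transition` supplies the identity. -/

theorem linSubst_linSubst (φ : R →+* S) (ψ : S →+* T) (M : GL (Fin 2) S) (N : GL (Fin 2) T) :
    (linSubst ψ N).comp (linSubst φ M) =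
      linSubst (ψ.comp φ) (Matrix.GeneralLinearGroup.map ψ M * N) := by
  have h : (linSubst ψ N).toRingHom.comp (linSubst φ M).toRingHom =
      (linSubst (ψ.comp φ) (Matrix.GeneralLinearGroup.map ψ M * N)).toRingHom := by
    refine MvPolynomial.ringHom_ext (fun a => ?_) (fun i => ?_)
    · change linSubst ψ N (linSubst φ M (C a)) = linSubst (ψ.comp φ) _ (C a)
      rw [linSubst_C, linSubst_C, linSubst_C, RingHom.comp_apply]
    · change linSubst ψ N (linSubst φ M (X i)) = linSubst (ψ.comp φ) _ (X i)
      rw [linSubst_X, linSubst_X, map_sum]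
      have h1 : ∀ j, linSubst ψ N (C (M.1 i j) * X j) =
          ∑ k, C (ψ (M.1 i j) * N.1 j k) * X k := by
        intro j
        rw [GradedRingHom.map_mul, linSubst_C, linSubst_X, Finset.mul_sum]
        simp only [C_mul, mul_assoc]
      simp only [h1, Units.val_mul, Matrix.mul_apply, map_sum, Finset.sum_mul]
      exact Finset.sum_comm
  exact DFunLike.ext _ _ fun p => DFunLike.congr_fun h p

/-- Composition of linear substitutions on relative projective lines. -/
theorem linMap_comp_linMap (φ : R →+* S) (ψ : S →+* T) (M : GL (Fin 2) S) (N : GL (Fin 2) T) :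
    linMap ψ N ≫ linMap φ M =
      linMap (ψ.comp φ) (Matrix.GeneralLinearGroup.map ψ M * N) := by
  refine (Proj.map_comp (linSubst φ M) (linSubst ψ N) (irrelevant_le_linSubst φ M)
    (irrelevant_le_linSubst ψ N)).symm.trans ?_
  simp only [linSubst_linSubst]
  rfl

theorem linMap_id_one : linMap (RingHom.id S) 1 = 𝟙 (ProjLineOver S) := by
  have h : linSubst (RingHom.id S) 1 = GradedRingHom.id (coordGrading S) :=
    DFunLike.ext _ _ fun p => by rw [linSubst_one, MvPolynomial.map_id]; rfl
  refine Eq.trans ?_ Proj.map_id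
  simp only [linMap, h]

instance isIso_linMap_id (M : GL (Fin 2) S) : IsIso (linMap (RingHom.id S) M) := by
  refine ⟨linMap (RingHom.id S) M⁻¹, ?_, ?_⟩ <;>
  · rw [linMap_comp_linMap, RingHom.id_comp, ← linMap_id_one]
    congr 1
    ext
    simp

/-- A scalar matrix acts on forms of degree `i` by the `i`-th power of the scalar. -/
theorem linSubst_scalar (z : Sˣ) {i : ℕ} {p : MvPolynomial (Fin 2) S} (hp : p ∈ coordGrading S i) :
    linSubst (RingHom.id S) (Matrix.GeneralLinearGroup.scalar (Fin 2) z) p =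
      p * C (z.1 ^ i) := by
  change eval₂ _ _ p = _
  conv_rhs => rw [p.as_sum]
  rw [eval₂_eq', Finset.sum_mul]
  refine Finset.sum_congr rfl fun e he => ?_
  -- Each monomial of `p` has total degree `i`, so it picks up exactly the factor `zⁱ`.
  have hdeg : ∑ j, e j = i := by
    have := (mem_homogeneousSubmodule i p).mp hp (mem_support_iff.mp he)
    rw [← this, Finsupp.weight_apply, Finsupp.sum_fintype _ _ (by simp)]
    simp
  have hX : ∀ k, ∑ j, C ((Matrix.GeneralLinearGroup.scalar (Fin 2) z).1 k j) * X j =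
      (C z.1 * X k : MvPolynomial (Fin 2) S) := by
    intro k
    fin_cases k <;> simp [Matrix.GeneralLinearGroup.scalar]
  simp only [hX, mul_pow, Finset.prod_mul_distrib, Finset.prod_pow_eq_pow_sum, hdeg,
    monomial_eq, Finsupp.prod_fintype _ _ (fun _ => pow_zero _), map_pow, RingHom.comp_apply,
    RingHom.id_apply]
  ring

/-- Scalar matrices act trivially on the projective line. -/
theorem linMap_scalar (z : Sˣ) :
    linMap (RingHom.id S) (Matrix.GeneralLinearGroup.scalar (Fin 2) z) =
      𝟙 (ProjLineOver S) := by
  set Z := Matrix.GeneralLinearGroup.scalar (Fin 2) z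
  refine (Proj.mapAffineOpenCover (linSubst (RingHom.id S) Z)
    (irrelevant_le_linSubst _ Z)).openCover.hom_ext _ _ fun s => ?_
  have key : ∀ (d : ℕ) (hd : 0 < d) (t : MvPolynomial (Fin 2) S) (ht : t ∈ coordGrading S d),
      Proj.awayι (coordGrading S) (linSubst (RingHom.id S) Z t)
          ((linSubst (RingHom.id S) Z).map_mem ht) hd ≫ linMap (RingHom.id S) Z =
        Proj.awayι (coordGrading S) (linSubst (RingHom.id S) Z t)
          ((linSubst (RingHom.id S) Z).map_mem ht) hd ≫ 𝟙 _ := by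
    intro d hd t ht
    have hC : ∀ k, C (z.1 ^ k) ∈ coordGrading S 0 := fun k => isHomogeneous_C _ _
    -- The substitution sends `t` to `t · zᵈ`, so the chart at its image also maps to the chart at
    -- `t` by plain further localisation at `zᵈ`. It remains to see that the two ring maps between
    -- these charts agree.
    rw [linMap, Proj.awayι_comp_map _ _ hd t ht, Category.comp_id,
      ← Proj.SpecMap_awayMap_awayι (coordGrading S) ht hd (hC d) (linSubst_scalar z ht)]
    have hring : Away.map (linSubst (RingHom.id S) Z) t =
        awayMap (coordGrading S) (hC d) (linSubst_scalar z ht) := by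
      ext1 x
      obtain ⟨k, a, ha, rfl⟩ := Away.mk_surjective (coordGrading S) ht x
      rw [Away.map_mk, awayMap_mk]
      apply HomogeneousLocalization.val_injective
      rw [Away.val_mk, Away.val_mk, linSubst_scalar z ha]
      -- For a fraction `a / tᵏ` of degree `0` the numerator has degree `k • d`, so both maps
      -- multiply it by `z` to the power `d * k`.
      congr 2
      rw [← map_pow, ← pow_mul, smul_eq_mul, mul_comm k d]
    rw [hring]
  exact key s.1 s.1.2 s.2 s.2.2

end Substitution

/-! ### Isomorphisms of glued projective bundles -/

open LaurentPolynomial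

namespace RankTwoBundle

variable {E F : RankTwoBundle} (A B : GL (Fin 2) (Polynomial ℂ)) (z : ℂ[T;T⁻¹]ˣ)

/-- Changes of frame over the two charts which turn one transition matrix into a multiple of
the other induce a morphism of the glued projective bundles. -/
def projMap
    (h : Matrix.GeneralLinearGroup.map chart₁ B * E.transition =
      F.transition * Matrix.GeneralLinearGroup.map chart₀ A *
        Matrix.GeneralLinearGroup.scalar (Fin 2) z) :
    E.proj ⟶ F.proj :=
  pushout.map _ _ _ _ (linMap (RingHom.id _) A) (linMap (RingHom.id _) B)
    -- The overlap enters the first chart with matrix `1`, so it carries the first frame and must be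
    -- moved by `A`.
    (linMap (RingHom.id _) (Matrix.GeneralLinearGroup.map chart₀ A))
    (by
      rw [linMap_comp_linMap, linMap_comp_linMap, map_one, one_mul, mul_one]
      rfl)
    (by
      -- By `h` the two ways round this square differ only by the scalar `z`, which is the identity
      -- on the projective line.
      have hF := linMap_comp_linMap chart₁ (RingHom.id _)
        (F.transition * Matrix.GeneralLinearGroup.map chart₀ A)
        (Matrix.GeneralLinearGroup.scalar (Fin 2) z)
      rw [linMap_scalar, Category.id_comp] at hF
      rw [linMap_comp_linMap, linMap_comp_linMap, h]
      exact hF.symm)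

variable (h : Matrix.GeneralLinearGroup.map chart₁ B * E.transition =
  F.transition * Matrix.GeneralLinearGroup.map chart₀ A *
    Matrix.GeneralLinearGroup.scalar (Fin 2) z)

instance isIso_projMap : IsIso (projMap A B z h) := by
  unfold projMap
  exact pushout.map_isIso ..

theorem projMap_projToP1 : projMap A B z h ≫ F.projToP1 = E.projToP1 := by
  -- A change of frame is the identity on coefficients, so it moves points only within the fibres
  -- over each chart.
  have hid : ∀ M : GL (Fin 2) (Polynomial ℂ), linMap (RingHom.id _) M ≫ ProjLineOver.toSpec _ =
      ProjLineOver.toSpec _ := fun M => by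
    rw [linMap_toSpec]
    exact (congrArg _ (Spec.map_id _)).trans (Category.comp_id _)
  apply pushout.hom_ext
  · refine (pushout.inl_desc_assoc _ _ _ _).trans <| (Category.assoc _ _ _).trans <|
      (congrArg (linMap (RingHom.id _) A ≫ ·) (pushout.inl_desc _ _ _)).trans <|
      Eq.trans ?_ (pushout.inl_desc _ _ _).symm
    exact (reassoc_of% hid A) _
  · refine (pushout.inr_desc_assoc _ _ _ _).trans <| (Category.assoc _ _ _).trans <|
      (congrArg (linMap (RingHom.id _) B ≫ ·) (pushout.inr_desc _ _ _)).trans <|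
      Eq.trans ?_ (pushout.inr_desc _ _ _).symm
    exact (reassoc_of% hid B) _

end RankTwoBundle

/-! ### The explicit splitting -/

/-- The change of frame over the first chart which splits `extBundle d m` projectively. -/
def splittingFrame₀ (n : ℕ) : GL (Fin 2) (Polynomial ℂ) :=
  Matrix.GeneralLinearGroup.mk'' !![-1, 0; Polynomial.X ^ n, 1] (by
    simp [Matrix.det_fin_two_of])

/-- The change of frame over the second chart which splits `extBundle d m` projectively. -/
def splittingFrame₁ (m : ℕ) : GL (Fin 2) (Polynomial ℂ) :=
  Matrix.GeneralLinearGroup.mk'' !![-Polynomial.X ^ m, 1; 1, 0] (by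
    simp [Matrix.det_fin_two_of])

/-- Both sides multiply out to the matrix with rows `(-uⁿ, 0)` and `(uᵐ⁺ⁿ, uᵐ)`; the zero is `-u⁻ᵐ ·
uᵐ + 1`. -/
theorem splittingFrame_transition {m n : ℕ} (hmn : n ≤ m) :
    Matrix.GeneralLinearGroup.map chart₁ (splittingFrame₁ m) * (extBundle (m + n) m).transition =
      (hirzebruchBundle (2 * m - (m + n))).transition *
        Matrix.GeneralLinearGroup.map chart₀ (splittingFrame₀ n) *
        Matrix.GeneralLinearGroup.scalar (Fin 2) (isUnit_T (R := ℂ) (n : ℤ)).unit := by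
  -- With `k = m - n` the truncated difference `2 * m - (m + n)` is a true one, equal to `k`.
  obtain ⟨k, rfl⟩ := Nat.exists_eq_add_of_le hmn
  have hk : 2 * (n + k) - (n + k + n) = k := by omega
  have h₀ : chart₀ Polynomial.X = T 1 := Polynomial.toLaurent_X
  have h₁ : chart₁ Polynomial.X = T (-1) := by simp [chart₁]
  rw [hk]
  apply Units.ext
  change !![-Polynomial.X ^ (n + k), 1; 1, 0].map chart₁ *
      !![T ((n + k + n : ℕ) : ℤ), T ((n + k : ℕ) : ℤ); 0, 1] =
    !![lineTransition 0, 0; 0, lineTransition (-(k : ℤ))] *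
      !![-1, 0; Polynomial.X ^ n, 1].map chart₀ * Matrix.scalar (Fin 2) (T (n : ℤ))
  have hs : Matrix.scalar (Fin 2) (T (n : ℤ) : ℂ[T;T⁻¹]) = !![T (n : ℤ), 0; 0, T (n : ℤ)] := by
    ext i j
    fin_cases i <;> fin_cases j <;> rfl
  have hmap : ∀ (f : Polynomial ℂ →+* ℂ[T;T⁻¹]) (a b c e : Polynomial ℂ),
      !![a, b; c, e].map f = !![f a, f b; f c, f e] := fun f a b c e => by
    ext i j
    fin_cases i <;> fin_cases j <;> rfl
  simp only [hs, hmap, Matrix.mul_fin_two, map_neg, map_pow, map_one, map_zero, h₀, h₁, T_pow,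
    lineTransition, mul_one, mul_zero, zero_mul, one_mul, add_zero, zero_add, neg_mul, neg_neg,
    ← T_add, neg_zero, T_zero]
  congr! 4
  all_goals push_cast
  all_goals ring_nf
  all_goals simp

end RuledSurface

end

theorem mainTheorem5 (m n d : ℕ) (hm : 0 < m) (hn : 0 < n) (hd : d = m + n) (hmn : n ≤ m) :
    ∃ e : (RuledSurface.extBundle d m).proj ≅ RuledSurface.Hirzebruch (2 * m - d),
      e.hom ≫ RuledSurface.Hirzebruch.toSpec (2 * m - d) =
          (RuledSurface.extBundle d m).projToSpec ∧
        e.hom ≫ RuledSurface.Hirzebruch.toP1 (2 * m - d) =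
          (RuledSurface.extBundle d m).projToP1 := by
  subst hd
  have h := RuledSurface.splittingFrame_transition hmn
  have hP1 := RuledSurface.RankTwoBundle.projMap_projToP1 _ _ _ h
  refine ⟨@asIso _ _ _ _ _ (RuledSurface.RankTwoBundle.isIso_projMap _ _ _ h), ?_, hP1⟩
  -- The structure morphisms to `Spec ℂ` factor through `P1`, so compatibility with the rulings
  -- suffices.
  exact (Category.assoc _ _ _).symm.trans (congrArg (· ≫ RuledSurface.P1.toSpec) hP1)
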